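/- Let $n,m,s,t$ be natural numbers, let $x=(x_1,\dots,x_n)$, $y=(y_1,\dots,y_m)$, and let $\mathcal Y\subset\mathbb R^m$ be compact. Let $\nu$ be a Borel measure on $\mathbb R^m$ with support $\operatorname{supp}(\nu)=\mathcal Y$ and $\int_{\mathcal Y}|h(y)|\,d\nu(y)<\infty$ for every $h\in\mathbb R[y]$. For $h=\sum_\beta h_\beta(x)y^\beta\in\mathbb R[x,y]$ put $\int_{\mathcal Y}h\,d\nu(y):=\sum_\beta h_\beta(x)\int_{\mathcal Y}y^\beta\,d\nu(y)\in\mathbb R[x]$. Let $f\in\mathbb R[x]$ and, for $j=1,\dots,s$, let $G_j$ be a symmetric $q_j\times q_j$ matrix with entries in $\mathbb R[x,y]$. Let $$\widehat{\mathcal X}=\{x\in\mathbb R^n : G_j(x,y)\succeq 0\ \text{ for all } j=1,\dots,s \text{ and all } y\in\mathcal Y\}.$$ For $I\subseteq\{1,\dots,n\}$ write $x(I)=(x_i)_{i\in I}$. Let $\mathcal I_1,\dots,\mathcal I_t\subseteq\{1,\dots,n\}$ and $\mathcal J_1,\dots,\mathcal J_t\subseteq\{1,\dots,s\}$ satisfy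 the following (correlative sparsity pattern): (0) $\bigcup_{\ell=1}^t\mathcal J_\ell=\{1,\dots,s\}$; (i) (running intersection property) for every $\ell=2,\dots,t$ there is $k<\ell$ with $\mathcal I_\ell\cap\bigcup_{j<\ell}\mathcal I_j\subseteq\mathcal I_k$; (ii) for every $\ell$ and every $j\in\mathcal J_\ell$, the entries of $G_j$ lie in $\mathbb R[x(\mathcal I_\ell),y]$; (iii) $f=f_1+\cdots+f_t$ with $f_\ell\in\mathbb R[x(\mathcal I_\ell)]$. A square matrix $\Sigma$ over a polynomial ring $A$ is called an SOS matrix over $A$ if $\Sigma=T^{\mathsf T}T$ for some $l\in\mathbb N$ and some matrix $T$ with $l$ rows and entries in $A$; an SOS polynomial in $A$ is a finite sum of squares of elements of $A$. Write $\langle A,B\rangle=\operatorname{tr}(A^{\mathsf T}B)$. For each $\ell$ let $$\mathcal Q^1(\mathbf G^\ell,\nu)=\Big\{\sigma_0+\sum_{j\in\mathcal J_\ell}\int_{\mathcal Y}\langle\Sigma_j,G_j\rangle\,d\nu(y)\Big\},$$ where $\sigma_0$ ranges over the SOS polynomials in $\mathbb R[x(\mathcal I_\ell)]$ and each $\Sigma_j$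 over the $q_j\times q_j$ SOS matrices over $\mathbb R[x(\mathcal I_\ell),y]$. Suppose that each $\mathcal Q^1(\mathbf G^\ell,\nu)$ is Archimedean, i.e. for every $\ell=1,\dots,t$ there is $C>0$ with $C-\sum_{i\in\mathcal I_\ell}x_i^2\in\mathcal Q^1(\mathbf G^\ell,\nu)$. If $f>0$ on $\widehat{\mathcal X}$, then there are $g_\ell\in\mathcal Q^1(\mathbf G^\ell,\nu)$, $\ell=1,\dots,t$, such that $f=g_1+\cdots+g_t$; that is, $f\in\sum_{\ell=1}^t\mathcal Q^1(\mathbf G^\ell,\nu)$. -/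

import Mathlib

noncomputable section

namespace SparsePMI

open MvPolynomial MeasureTheory

/-- The subring `ℝ[x(I)]` of `ℝ[x]`: polynomials involving only the variables `x i` with `i ∈ I`. -/
def xRing {n : ℕ} (I : Finset (Fin n)) : Subalgebra ℝ (MvPolynomial (Fin n) ℝ) :=
  supported ℝ (I : Set (Fin n))

/-- The subring `ℝ[x(I), y]` of `ℝ[x, y]`; the `x`-variables are indexed by `Sum.inl`,
the `y`-variables by `Sum.inr`. -/
def xyRing {n : ℕ} (m : ℕ) (I : Finset (Fin n)) :
    Subalgebra ℝ (MvPolynomial (Fin n ⊕ Fin m) ℝ) :=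
  supported ℝ (Sum.inl '' (I : Set (Fin n)) ∪ Set.range Sum.inr)

/-- `σ` is a sum of squares of finitely many elements of the subring `A`. -/
def IsSOS {R : Type*} [CommRing R] [Algebra ℝ R] (A : Subalgebra ℝ R) (σ : R) : Prop :=
  ∃ (l : ℕ) (g : Fin l → R), (∀ i, g i ∈ A) ∧ σ = ∑ i, g i ^ 2

/-- `S` is an SOS matrix over the subring `A`: `S = Tᵀ T` for some `l × q` matrix `T` with
entries in `A`. -/
def IsSOSMatrix {R : Type*} [CommRing R] [Algebra ℝ R] (A : Subalgebra ℝ R) {q : ℕ}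
    (S : Matrix (Fin q) (Fin q) R) : Prop :=
  ∃ (l : ℕ) (T : Matrix (Fin l) (Fin q) R), (∀ i k, T i k ∈ A) ∧ S = T.transpose * T

/-- `h(x, y)` written as a polynomial in `y` with coefficients in `ℝ[x]`. -/
def asPolyInY {n m : ℕ} (h : MvPolynomial (Fin n ⊕ Fin m) ℝ) :
    MvPolynomial (Fin m) (MvPolynomial (Fin n) ℝ) :=
  sumAlgEquiv ℝ (Fin m) (Fin n) (rename Sum.swap h)

/-- For `h = ∑ β, h_β(x) y^β`, the polynomial
`∫_Y h(x, y) dν(y) = ∑ β, h_β(x) ∫_Y y^β dν(y)` in `ℝ[x]`. -/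
def integralY {n m : ℕ} (ν : Measure (Fin m → ℝ)) (Y : Set (Fin m → ℝ))
    (h : MvPolynomial (Fin n ⊕ Fin m) ℝ) : MvPolynomial (Fin n) ℝ :=
  ∑ β ∈ (asPolyInY h).support,
    coeff β (asPolyInY h) * C (∫ y in Y, ∏ j, y j ^ β j ∂ν)

/-- The inner product `⟨A, B⟩ = tr(Aᵀ B)` of square matrices. -/
def matInner {R : Type*} [CommRing R] {q : ℕ} (A B : Matrix (Fin q) (Fin q) R) : R :=
  (A.transpose * B).trace

/-- The value at `(x, y)` of a matrix with entries in `ℝ[x, y]`. -/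
def evalMat {n m q : ℕ} (G : Matrix (Fin q) (Fin q) (MvPolynomial (Fin n ⊕ Fin m) ℝ))
    (x : Fin n → ℝ) (y : Fin m → ℝ) : Matrix (Fin q) (Fin q) ℝ :=
  G.map (eval (Sum.elim x y))

/-- The set `{x ∈ ℝⁿ | G_j(x, y) ⪰ 0 for all j and all y ∈ Y}`. -/
def feasibleSet {n m s : ℕ} {q : Fin s → ℕ} (Y : Set (Fin m → ℝ))
    (G : (j : Fin s) → Matrix (Fin (q j)) (Fin (q j)) (MvPolynomial (Fin n ⊕ Fin m) ℝ)) :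
    Set (Fin n → ℝ) :=
  {x | ∀ j, ∀ y ∈ Y, (evalMat (G j) x y).PosSemidef}

/-- The quadratic module in `ℝ[x(I)]` generated by `(G_j)_{j ∈ J}` and `ν`: all polynomials
`σ₀ + ∑_{j ∈ J} ∫_Y ⟨Σ_j, G_j⟩ dν(y)` with `σ₀` an SOS in `ℝ[x(I)]` and `Σ_j` SOS matrices
over `ℝ[x(I), y]`. -/
def quadModule {n m s : ℕ} {q : Fin s → ℕ} (ν : Measure (Fin m → ℝ)) (Y : Set (Fin m → ℝ))
    (G : (j : Fin s) → Matrix (Fin (q j)) (Fin (q j)) (MvPolynomial (Fin n ⊕ Fin m) ℝ))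
    (I : Finset (Fin n)) (J : Finset (Fin s)) : Set (MvPolynomial (Fin n) ℝ) :=
  {g | ∃ (σ₀ : MvPolynomial (Fin n) ℝ)
      (S : (j : Fin s) → Matrix (Fin (q j)) (Fin (q j)) (MvPolynomial (Fin n ⊕ Fin m) ℝ)),
      IsSOS (xRing I) σ₀ ∧ (∀ j ∈ J, IsSOSMatrix (xyRing m I) (S j)) ∧
      g = σ₀ + ∑ j ∈ J, integralY ν Y (matInner (S j) (G j))}

/-- A quadratic module `Q` in `ℝ[x(I)]` is Archimedean: `C - ‖x(I)‖² ∈ Q` for some `C > 0`. -/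
def IsArchimedean {n : ℕ} (I : Finset (Fin n)) (Q : Set (MvPolynomial (Fin n) ℝ)) : Prop :=
  ∃ c : ℝ, 0 < c ∧ C c - ∑ i ∈ I, X i ^ 2 ∈ Q

/-- The running intersection property of `I_1, …, I_t`: for every `ℓ` other than the first there
is `k < ℓ` with `I_ℓ ∩ ⋃_{j < ℓ} I_j ⊆ I_k`. -/
def RunningIntersection {n t : ℕ} (I : Fin t → Finset (Fin n)) : Prop :=
  ∀ ℓ : Fin t, 0 < (ℓ : ℕ) → ∃ k < ℓ, I ℓ ∩ (Finset.Iio ℓ).biUnion I ⊆ I k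

/-- The correlative sparsity pattern for the data `f`, `(G_j)`, with respect to the variable
blocks `I_ℓ` and the constraint blocks `J_ℓ`. -/
structure CorrelativeSparsity {n m s t : ℕ} {q : Fin s → ℕ}
    (f : MvPolynomial (Fin n) ℝ)
    (G : (j : Fin s) → Matrix (Fin (q j)) (Fin (q j)) (MvPolynomial (Fin n ⊕ Fin m) ℝ))
    (I : Fin t → Finset (Fin n)) (J : Fin t → Finset (Fin s)) : Prop where
  /-- every constraint belongs to some block -/
  cover : ∀ j, ∃ ℓ, j ∈ J ℓ
  /-- the running intersection property -/
  rip : RunningIntersection I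
  /-- the constraints of block `ℓ` involve, besides `y`, only the variables `x(I_ℓ)` -/
  constraints : ∀ ℓ, ∀ j ∈ J ℓ, ∀ a b, G j a b ∈ xyRing m (I ℓ)
  /-- `f = f_1 + ⋯ + f_t` with `f_ℓ ∈ ℝ[x(I_ℓ)]` -/
  objective : ∃ F : Fin t → MvPolynomial (Fin n) ℝ, (∀ ℓ, F ℓ ∈ xRing (I ℓ)) ∧ f = ∑ ℓ, F ℓ

end SparsePMI

end

/-!
The proof has three independent ingredients.

*The Jacobi–Putinar representation theorem*
(`SparsePMI.IsQuadraticModule.mem_of_forall_algHom_pos`). If `Q` is an Archimedean quadratic module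
of a commutative `ℝ`-algebra and `f` is positive at every real character that is nonnegative on
`Q`, then `f ∈ Q`. A maximal proper quadratic module is total and Archimedean, so "standard part"
is a real character on the algebra; multiplicativity comes from
`2 r (r² - a²) = (r + a)² (r - a) + (r - a)² (r + a)`. Applied to `Q - Σ f`, this yields
`p f ∈ 1 + Q` for some sum of squares `p`, and the Archimedean property then lifts a lower bound
for `f` in steps of fixed size until it becomes nonnegative.

*Splitting along the running intersection property* (`SparsePMI.exists_blockwise_pos`). For two
blocks with shared variables `x(S)`, a continuous function of `x(S)` can be inserted between
`-f₂` and `f₁` fibrewise over `x(S)` (`SparsePMI.exists_continuous_between`). By compactness and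
Weierstrass approximation it may be taken to be a polynomial, which is subtracted from `f₁` and
added to `f₂`. Induction on the number of blocks gives `f = ∑ g_ℓ` with `g_ℓ ∈ ℝ[x(I_ℓ)]` positive
on the positivity set of the `ℓ`-th quadratic module.

*Positivity sets* (`SparsePMI.posSemidef_of_quadModule_nonneg`). A point at which the `ℓ`-th
quadratic module is nonnegative satisfies `G_j(x, y) ⪰ 0` for `j ∈ J_ℓ` and all `y ∈ Y`: the
module contains `∫ p(y)² vᵀ G_j(x, y) v dν(y)`, and squares of polynomials in `y` are dense enough
to detect negativity anywhere on the support of `ν`.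

Hence the blockwise positivity sets jointly cut out a subset of the feasible set, on which `f` is
positive, and the first ingredient puts each `g_ℓ` in its own quadratic module. The real characters
of `ℝ[x(I)]` are evaluations, and points of `ℝ^I` are represented throughout by points of `ℝⁿ`
whose coordinates outside `I` vanish.
-/

namespace SparsePMI

open MvPolynomial MeasureTheory

/-! ### Archimedean quadratic modules -/

/-- A quadratic module of a commutative ring: a subset containing `1`, closed under addition and
under multiplication by squares. It is not required to be proper. -/
structure IsQuadraticModule {A : Type*} [CommRing A] (Q : Set A) : Prop where
  one_mem : 1 ∈ Q
  add_mem : ∀ {a b}, a ∈ Q → b ∈ Q → a + b ∈ Q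
  sq_mul_mem : ∀ (a) {b}, b ∈ Q → a ^ 2 * b ∈ Q

namespace IsQuadraticModule

variable {A : Type*} [CommRing A] {Q : Set A}

theorem sq_mem (hQ : IsQuadraticModule Q) (a : A) : a ^ 2 ∈ Q := by
  simpa using hQ.sq_mul_mem a hQ.one_mem

theorem zero_mem (hQ : IsQuadraticModule Q) : (0 : A) ∈ Q := by
  simpa using hQ.sq_mem 0

theorem sum_mem (hQ : IsQuadraticModule Q) {ι : Type*} {s : Finset ι} {a : ι → A}
    (h : ∀ i ∈ s, a i ∈ Q) : ∑ i ∈ s, a i ∈ Q :=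
  Finset.sum_induction a (· ∈ Q) (fun _ _ => hQ.add_mem) hQ.zero_mem h

theorem isSumSq_mul_mem (hQ : IsQuadraticModule Q) {p b : A} (hp : IsSumSq p) (hb : b ∈ Q) :
    p * b ∈ Q := by
  induction hp with
  | zero => simpa using hQ.zero_mem
  | sq_add a _ ih => rw [add_mul, ← pow_two]; exact hQ.add_mem (hQ.sq_mul_mem a hb) ih

theorem isSumSq_mem (hQ : IsQuadraticModule Q) {p : A} (hp : IsSumSq p) : p ∈ Q := by
  simpa using hQ.isSumSq_mul_mem hp hQ.one_mem

/-- The quadratic module generated by a quadratic module and one more element. -/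
theorem adjoin (hQ : IsQuadraticModule Q) (a : A) :
    IsQuadraticModule {b | ∃ q ∈ Q, ∃ p, IsSumSq p ∧ b = q + p * a} where
  one_mem := ⟨1, hQ.one_mem, 0, .zero, by simp⟩
  add_mem := by
    rintro _ _ ⟨q, hq, p, hp, rfl⟩ ⟨q', hq', p', hp', rfl⟩
    exact ⟨q + q', hQ.add_mem hq hq', p + p', hp.add hp', by ring⟩
  sq_mul_mem := by
    rintro c _ ⟨q, hq, p, hp, rfl⟩
    refine ⟨c ^ 2 * q, hQ.sq_mul_mem c hq, c ^ 2 * p, ?_, by ring⟩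
    exact (pow_two c ▸ IsSumSq.mul_self c).mul hp

variable [Algebra ℝ A]

theorem algebraMap_mul_mem (hQ : IsQuadraticModule Q) {r : ℝ} (hr : 0 ≤ r) {b : A} (hb : b ∈ Q) :
    algebraMap ℝ A r * b ∈ Q := by
  have := hQ.sq_mul_mem (algebraMap ℝ A √r) hb
  rwa [← map_pow, Real.sq_sqrt hr] at this

theorem algebraMap_mem (hQ : IsQuadraticModule Q) {r : ℝ} (hr : 0 ≤ r) :
    algebraMap ℝ A r ∈ Q := by
  simpa using hQ.algebraMap_mul_mem hr hQ.one_mem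

theorem mem_of_algebraMap_mul_mem (hQ : IsQuadraticModule Q) {r : ℝ} (hr : 0 < r) {b : A}
    (hb : algebraMap ℝ A r * b ∈ Q) : b ∈ Q := by
  have := hQ.algebraMap_mul_mem (inv_nonneg.2 hr.le) hb
  rwa [← mul_assoc, ← map_mul, inv_mul_cancel₀ hr.ne', map_one, one_mul] at this

theorem neg_one_mem_of_algebraMap_mem (hQ : IsQuadraticModule Q) {r : ℝ} (hr : r < 0)
    (h : algebraMap ℝ A r ∈ Q) : (-1 : A) ∈ Q := by
  refine hQ.mem_of_algebraMap_mul_mem (neg_pos.2 hr) ?_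
  simpa using h

/-- The support `Q ∩ -Q` of a quadratic module absorbs multiplication, because every ring element
is a difference of two squares when `2` is invertible. -/
theorem mul_mem_of_mem_of_neg_mem (hQ : IsQuadraticModule Q) {a : A} (ha : a ∈ Q) (ha' : -a ∈ Q)
    (b : A) : b * a ∈ Q := by
  refine hQ.mem_of_algebraMap_mul_mem (r := 4) (by norm_num) ?_
  have := hQ.add_mem (hQ.sq_mul_mem (b + 1) ha) (hQ.sq_mul_mem (b - 1) ha')
  convert this using 1
  simp only [map_ofNat]
  ring

/-- If `r ± a` lie in a quadratic module, then so does `r² - a²`. -/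
theorem sq_sub_sq_mem (hQ : IsQuadraticModule Q) {r : ℝ} (hr : 0 < r) {a : A}
    (h₁ : algebraMap ℝ A r + a ∈ Q) (h₂ : algebraMap ℝ A r - a ∈ Q) :
    algebraMap ℝ A (r ^ 2) - a ^ 2 ∈ Q := by
  refine hQ.mem_of_algebraMap_mul_mem (r := 2 * r) (by positivity) ?_
  have := hQ.add_mem (hQ.sq_mul_mem (algebraMap ℝ A r + a) h₂)
    (hQ.sq_mul_mem (algebraMap ℝ A r - a) h₁)
  convert this using 1
  simp only [map_mul, map_pow, map_ofNat]
  ring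

/-- A maximal proper quadratic module is total. -/
theorem mem_or_neg_mem_of_maximal {N : Set A}
    (hN : Maximal (fun N : Set A => IsQuadraticModule N ∧ (-1 : A) ∉ N) N) (a : A) :
    a ∈ N ∨ -a ∈ N := by
  obtain ⟨hQ, h1⟩ := hN.prop
  have key : ∀ b, b ∉ N → ∃ q ∈ N, ∃ p, IsSumSq p ∧ -1 = q + p * b := by
    intro b hb
    by_contra hcon
    refine hb (hN.le_of_ge ⟨hQ.adjoin b, hcon⟩ ?_ ?_)
    · exact fun c hc => ⟨c, hc, 0, .zero, by simp⟩
    · exact ⟨0, hQ.zero_mem, 1, by simp, by simp⟩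
  by_contra! hcon
  obtain ⟨q, hq, p, hp, e⟩ := key a hcon.1
  obtain ⟨q', hq', p', hp', e'⟩ := key (-a) hcon.2
  have hneg : -p ∈ N := by
    have h : -p = p' + p * q' + p' * q := by linear_combination p' * e + p * e'
    rw [h]
    exact hQ.add_mem (hQ.add_mem (hQ.isSumSq_mem hp') (hQ.isSumSq_mul_mem hp hq'))
      (hQ.isSumSq_mul_mem hp' hq)
  refine h1 (e ▸ hQ.add_mem hq ?_)
  rw [mul_comm]
  exact hQ.mul_mem_of_mem_of_neg_mem (hQ.isSumSq_mem hp) hneg a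

/-- `a` equals the real number `r` up to an infinitesimal, for the preordering
`a ≤ b ↔ b - a ∈ N`. -/
def InfinitelyClose (N : Set A) (a : A) (r : ℝ) : Prop :=
  ∀ ε : ℝ, 0 < ε → algebraMap ℝ A ε + (a - algebraMap ℝ A r) ∈ N ∧
    algebraMap ℝ A ε - (a - algebraMap ℝ A r) ∈ N

namespace InfinitelyClose

variable {N : Set A} {a b : A} {r s : ℝ}

theorem unique (hN : IsQuadraticModule N) (h1 : (-1 : A) ∉ N)
    (hr : InfinitelyClose N a r) (hs : InfinitelyClose N a s) : r = s := by
  have key : ∀ {r s}, InfinitelyClose N a r → InfinitelyClose N a s → ¬ r < s := by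
    intro r s hr hs hlt
    have hε : 0 < (s - r) / 3 := by linarith
    have h := hN.add_mem (hr _ hε).2 (hs _ hε).1
    refine h1 (hN.neg_one_mem_of_algebraMap_mem (r := (r - s) / 3) (by linarith) ?_)
    convert h using 1
    rw [show (r - s) / 3 = (s - r) / 3 + (s - r) / 3 + r - s by ring]
    simp only [map_add, map_sub]
    ring
  exact le_antisymm (not_lt.1 (key hs hr)) (not_lt.1 (key hr hs))

theorem of_algebraMap (hN : IsQuadraticModule N) (r : ℝ) :
    InfinitelyClose N (algebraMap ℝ A r) r := fun ε hε => by
  simpa using hN.algebraMap_mem hε.le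

theorem add (hN : IsQuadraticModule N) (ha : InfinitelyClose N a r)
    (hb : InfinitelyClose N b s) : InfinitelyClose N (a + b) (r + s) := fun ε hε => by
  have e : algebraMap ℝ A ε = algebraMap ℝ A (ε / 2) + algebraMap ℝ A (ε / 2) := by
    rw [← map_add, add_halves]
  constructor
  · convert hN.add_mem (ha _ (half_pos hε)).1 (hb _ (half_pos hε)).1 using 1
    rw [e, map_add]; ring
  · convert hN.add_mem (ha _ (half_pos hε)).2 (hb _ (half_pos hε)).2 using 1
    rw [e, map_add]; ring

theorem neg (ha : InfinitelyClose N a r) : InfinitelyClose N (-a) (-r) := fun ε hε => by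
  constructor
  · convert (ha ε hε).2 using 1; rw [map_neg]; ring
  · convert (ha ε hε).1 using 1; rw [map_neg]; ring

theorem smul (hN : IsQuadraticModule N) (ha : InfinitelyClose N a r) (c : ℝ) :
    InfinitelyClose N (c • a) (c * r) := by
  have pos : ∀ c : ℝ, 0 < c → InfinitelyClose N (c • a) (c * r) := fun c hc ε hε => by
    have e : algebraMap ℝ A ε = algebraMap ℝ A c * algebraMap ℝ A (ε / c) := by
      rw [← map_mul, mul_div_cancel₀ _ hc.ne']
    constructor
    · convert hN.algebraMap_mul_mem hc.le (ha _ (div_pos hε hc)).1 using 1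
      rw [e, map_mul, Algebra.smul_def]; ring
    · convert hN.algebraMap_mul_mem hc.le (ha _ (div_pos hε hc)).2 using 1
      rw [e, map_mul, Algebra.smul_def]; ring
  rcases lt_trichotomy c 0 with hc | rfl | hc
  · simpa using (pos (-c) (neg_pos.2 hc)).neg
  · simpa using InfinitelyClose.of_algebraMap hN (0 : ℝ)
  · exact pos c hc

theorem sq_zero (hN : IsQuadraticModule N) (ha : InfinitelyClose N a 0) :
    InfinitelyClose N (a ^ 2) 0 := fun ε hε => by
  have h := ha _ (Real.sqrt_pos.2 hε)
  simp only [map_zero, sub_zero] at h ⊢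
  refine ⟨hN.add_mem (hN.algebraMap_mem hε.le) (hN.sq_mem a), ?_⟩
  have := hN.sq_sub_sq_mem (Real.sqrt_pos.2 hε) h.1 h.2
  rwa [Real.sq_sqrt hε.le] at this

theorem sq (hN : IsQuadraticModule N) (ha : InfinitelyClose N a r) :
    InfinitelyClose N (a ^ 2) (r ^ 2) := by
  have h0 : InfinitelyClose N (a - algebraMap ℝ A r) 0 := by
    simpa [sub_eq_add_neg] using ha.add hN (InfinitelyClose.of_algebraMap hN r).neg
  have h := ((h0.sq_zero hN).add hN (ha.smul hN (2 * r))).add hN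
    (InfinitelyClose.of_algebraMap hN (-r ^ 2))
  convert h using 1
  · rw [Algebra.smul_def]; simp only [map_mul, map_neg, map_pow, map_ofNat]; ring
  · ring

theorem mul (hN : IsQuadraticModule N) (ha : InfinitelyClose N a r)
    (hb : InfinitelyClose N b s) : InfinitelyClose N (a * b) (r * s) := by
  have h := ((((ha.add hN hb).sq hN).add hN ((ha.sq hN).neg)).add hN ((hb.sq hN).neg)).smul hN
    (1 / 2)
  convert h using 1
  · rw [show (a + b) ^ 2 + -a ^ 2 + -b ^ 2 = (2 : ℝ) • (a * b) by
      rw [Algebra.smul_def, map_ofNat]; ring, smul_smul]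
    norm_num
  · ring

end InfinitelyClose

/-- In a total, proper, Archimedean quadratic module, every element has a standard part. -/
theorem exists_infinitelyClose {N : Set A} (hN : IsQuadraticModule N) (h1 : (-1 : A) ∉ N)
    (htot : ∀ a, a ∈ N ∨ -a ∈ N) (harch : ∀ a : A, ∃ r : ℝ, algebraMap ℝ A r - a ∈ N) (a : A) :
    ∃ r, InfinitelyClose N a r := by
  set L : Set ℝ := {r | a - algebraMap ℝ A r ∈ N} with hL
  have hne : L.Nonempty := by
    obtain ⟨r, hr⟩ := harch (-a)
    exact ⟨-r, by simpa [hL, add_comm] using hr⟩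
  have hbdd : BddAbove L := by
    obtain ⟨r, hr⟩ := harch a
    refine ⟨r, fun s hs => not_lt.1 fun hlt => h1 ?_⟩
    refine hN.neg_one_mem_of_algebraMap_mem (r := r - s) (by linarith) ?_
    convert hN.add_mem hr hs using 1
    rw [map_sub]; ring
  refine ⟨sSup L, fun ε hε => ⟨?_, ?_⟩⟩
  · obtain ⟨r, hr, hlt⟩ := exists_lt_of_lt_csSup hne (sub_lt_self (sSup L) hε)
    convert hN.add_mem hr (hN.algebraMap_mem (r := r - (sSup L - ε)) (by linarith)) using 1
    simp only [map_sub]; ring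
  · have hnot : sSup L + ε ∉ L := fun h => by linarith [le_csSup hbdd h]
    convert (htot _).resolve_left hnot using 1
    simp only [map_add]; ring

/-- A proper Archimedean quadratic module is nonnegative under some real character. -/
theorem exists_algHom_nonneg (hQ : IsQuadraticModule Q) (h1 : (-1 : A) ∉ Q)
    (harch : ∀ a : A, ∃ r : ℝ, algebraMap ℝ A r - a ∈ Q) :
    ∃ φ : A →ₐ[ℝ] ℝ, ∀ a ∈ Q, 0 ≤ φ a := by
  obtain ⟨N, hQN, hmax⟩ := zorn_subset_nonempty
    {N : Set A | IsQuadraticModule N ∧ (-1 : A) ∉ N} (by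
      intro c hc hchain hne
      refine ⟨⋃₀ c, ⟨⟨?_, ?_, ?_⟩, ?_⟩, fun s hs => Set.subset_sUnion_of_mem hs⟩
      · obtain ⟨s, hs⟩ := hne
        exact ⟨s, hs, (hc hs).1.one_mem⟩
      · rintro a b ⟨s, hs, ha⟩ ⟨s', hs', hb⟩
        rcases hchain.total hs hs' with h | h
        · exact ⟨s', hs', (hc hs').1.add_mem (h ha) hb⟩
        · exact ⟨s, hs, (hc hs).1.add_mem ha (h hb)⟩
      · rintro a b ⟨s, hs, hb⟩
        exact ⟨s, hs, (hc hs).1.sq_mul_mem a hb⟩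
      · rintro ⟨s, hs, h⟩
        exact (hc hs).2 h) Q ⟨hQ, h1⟩
  obtain ⟨hN, hN1⟩ := hmax.prop
  have htot := mem_or_neg_mem_of_maximal hmax
  choose φ hφ using hN.exists_infinitelyClose hN1 htot fun a => (harch a).imp fun _ h => hQN h
  have huniq : ∀ {a r}, InfinitelyClose N a r → φ a = r := fun h => (hφ _).unique hN hN1 h
  refine ⟨
    { toFun := φ
      map_one' := huniq (by simpa using InfinitelyClose.of_algebraMap hN (1 : ℝ))
      map_zero' := huniq (by simpa using InfinitelyClose.of_algebraMap hN (0 : ℝ))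
      map_add' := fun a b => huniq ((hφ a).add hN (hφ b))
      map_mul' := fun a b => huniq ((hφ a).mul hN (hφ b))
      commutes' := fun r => huniq (InfinitelyClose.of_algebraMap hN r) }, fun a ha => ?_⟩
  change 0 ≤ φ a
  by_contra! hlt
  refine hN1 (hN.neg_one_mem_of_algebraMap_mem (r := φ a / 2) (by linarith) ?_)
  convert hN.add_mem (hQN ha) (hφ a (-φ a / 2) (by linarith)).2 using 1
  rw [show φ a / 2 = -φ a / 2 + φ a by ring, map_add]
  ring

/-- If `p * f = 1 + q` with `p` a sum of squares and `q ∈ Q`, then `f` belongs to the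
Archimedean quadratic module `Q`. -/
theorem mem_of_isSumSq_mul_eq (hQ : IsQuadraticModule Q)
    (harch : ∀ a : A, ∃ r : ℝ, algebraMap ℝ A r - a ∈ Q) {f p q : A} (hp : IsSumSq p)
    (hq : q ∈ Q) (e : p * f = 1 + q) : f ∈ Q := by
  have mono : ∀ {a : A} {r s : ℝ}, r ≤ s → algebraMap ℝ A r - a ∈ Q →
      algebraMap ℝ A s - a ∈ Q := fun {a r s} hrs h => by
    convert hQ.add_mem (hQ.algebraMap_mem (sub_nonneg.2 hrs)) h using 1
    rw [map_sub]; ring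
  obtain ⟨r₁, h₁⟩ := harch (p ^ 2 * f + 1)
  obtain ⟨r₂, h₂⟩ := harch p
  obtain ⟨k, hk, hk₁, hk₂⟩ : ∃ k : ℝ, 0 < k ∧ r₁ ≤ 2 * k ∧ r₂ ≤ 2 * k :=
    ⟨max 1 (max r₁ r₂), by positivity, by
      linarith [le_max_left r₁ r₂, le_max_right 1 (max r₁ r₂), le_max_left 1 (max r₁ r₂)], by
      linarith [le_max_right r₁ r₂, le_max_right 1 (max r₁ r₂), le_max_left 1 (max r₁ r₂)]⟩
  replace h₁ := mono hk₁ h₁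
  replace h₂ := mono hk₂ h₂
  -- A nonnegative lower bound `-r` of `f` can be improved by the fixed amount `1 / k²`.
  have step : ∀ r : ℝ, 0 ≤ r → f + algebraMap ℝ A r ∈ Q →
      f + algebraMap ℝ A (r - 1 / k ^ 2) ∈ Q := by
    intro r hr h
    refine hQ.mem_of_algebraMap_mul_mem (r := k ^ 2) (by positivity) ?_
    have hsum := hQ.add_mem (hQ.add_mem (hQ.add_mem
      (hQ.sq_mul_mem (algebraMap ℝ A k - p) h) h₁)
      (hQ.algebraMap_mul_mem (r := 2 * k) (by positivity) hq))
      (hQ.algebraMap_mul_mem hr (hQ.isSumSq_mul_mem hp h₂))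
    convert hsum using 1
    rw [mul_add, ← map_mul, show k ^ 2 * (r - 1 / k ^ 2) = k ^ 2 * r - 1 by field_simp]
    simp only [map_mul, map_pow, map_sub, map_one, map_ofNat]
    linear_combination (2 * algebraMap ℝ A k) * e
  have iter : ∀ (d : ℕ) (r : ℝ), r ≤ d * (1 / k ^ 2) → f + algebraMap ℝ A r ∈ Q → f ∈ Q := by
    intro d
    induction d with
    | zero =>
      intro r hr h
      convert hQ.add_mem h (hQ.algebraMap_mem (r := -r) (by simpa using hr)) using 1
      rw [map_neg]; ring
    | succ d ih =>
      intro r hr h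
      rcases le_total 0 r with h0 | h0
      · refine ih (r - 1 / k ^ 2) ?_ (step r h0 h)
        push_cast at hr
        linarith
      · exact ih r (h0.trans (by positivity)) h
  obtain ⟨r, hr⟩ := harch (-f)
  obtain ⟨d, hd⟩ := exists_nat_ge (r / (1 / k ^ 2))
  exact iter d r ((div_le_iff₀ (by positivity)).1 hd) (by simpa [add_comm] using hr)

/-- The representation theorem of Jacobi and Putinar: an element that is positive at every real
character nonnegative on the Archimedean quadratic module `Q` belongs to `Q`. -/
theorem mem_of_forall_algHom_pos (hQ : IsQuadraticModule Q)
    (harch : ∀ a : A, ∃ r : ℝ, algebraMap ℝ A r - a ∈ Q) {f : A}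
    (hf : ∀ φ : A →ₐ[ℝ] ℝ, (∀ a ∈ Q, 0 ≤ φ a) → 0 < φ f) : f ∈ Q := by
  have hQ' := hQ.adjoin (-f)
  have hsub : ∀ a ∈ Q, ∃ q ∈ Q, ∃ p, IsSumSq p ∧ a = q + p * -f :=
    fun a ha => ⟨a, ha, 0, .zero, by simp⟩
  by_cases h1 : ∃ q ∈ Q, ∃ p, IsSumSq p ∧ (-1 : A) = q + p * -f
  · obtain ⟨q, hq, p, hp, e⟩ := h1
    exact hQ.mem_of_isSumSq_mul_eq harch hp hq (by linear_combination e)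
  · obtain ⟨φ, hφ⟩ := hQ'.exists_algHom_nonneg h1 fun a => (harch a).imp fun _ h => hsub _ h
    have h0 := hf φ fun a ha => hφ a (hsub a ha)
    have h2 := hφ (-f) ⟨0, hQ.zero_mem, 1, by simp, by simp⟩
    rw [map_neg] at h2
    linarith

/-- The elements bounded with respect to a quadratic module form a subalgebra. -/
def boundedSubalgebra (hQ : IsQuadraticModule Q) : Subalgebra ℝ A where
  carrier := {a | ∃ r : ℝ, 0 < r ∧ algebraMap ℝ A r + a ∈ Q ∧ algebraMap ℝ A r - a ∈ Q}
  algebraMap_mem' c := ⟨|c| + 1, by positivity, by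
    rw [← map_add]; exact hQ.algebraMap_mem (by linarith [neg_abs_le c]), by
    rw [← map_sub]; exact hQ.algebraMap_mem (by linarith [le_abs_self c])⟩
  add_mem' := by
    rintro a b ⟨r, hr, h₁, h₂⟩ ⟨s, hs, h₃, h₄⟩
    refine ⟨r + s, by positivity, ?_, ?_⟩
    · convert hQ.add_mem h₁ h₃ using 1; rw [map_add]; ring
    · convert hQ.add_mem h₂ h₄ using 1; rw [map_add]; ring
  mul_mem' := by
    rintro a b ⟨r, hr, h₁, h₂⟩ ⟨s, hs, h₃, h₄⟩
    have key : ∀ {a b : A} {r s : ℝ}, 0 < r → 0 < s → algebraMap ℝ A r + a ∈ Q →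
        algebraMap ℝ A r - a ∈ Q → algebraMap ℝ A s + b ∈ Q → algebraMap ℝ A s - b ∈ Q →
        algebraMap ℝ A ((r + s) ^ 2) + a * b ∈ Q := by
      intro a b r s hr hs h₁ h₂ h₃ h₄
      have hm := hQ.sq_sub_sq_mem (add_pos hr hs) (a := a - b)
        (by convert hQ.add_mem h₁ h₄ using 1; rw [map_add]; ring)
        (by convert hQ.add_mem h₂ h₃ using 1; rw [map_add]; ring)
      refine hQ.mem_of_algebraMap_mul_mem (r := 4) (by norm_num) ?_
      convert hQ.add_mem (hQ.add_mem hm (hQ.sq_mem (a + b)))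
        (hQ.algebraMap_mem (r := 3 * (r + s) ^ 2) (by positivity)) using 1
      simp only [map_mul, map_pow, map_ofNat]
      ring
    refine ⟨(r + s) ^ 2, by positivity, key hr hs h₁ h₂ h₃ h₄, ?_⟩
    have := key (a := a) (b := -b) hr hs h₁ h₂ (by simpa [sub_eq_add_neg] using h₄)
      (by simpa using h₃)
    convert this using 1
    ring

theorem mem_boundedSubalgebra_of_sq (hQ : IsQuadraticModule Q) {c : ℝ} (hc : 0 < c) {a : A}
    (h : algebraMap ℝ A c - a ^ 2 ∈ Q) : a ∈ hQ.boundedSubalgebra := by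
  have e : algebraMap ℝ A (c + 1 / 4) = algebraMap ℝ A c + (algebraMap ℝ A (1 / 2)) ^ 2 := by
    rw [← map_pow, ← map_add]; norm_num
  have e2 : 2 * algebraMap ℝ A (1 / 2) = 1 := by
    rw [← map_ofNat (algebraMap ℝ A) 2, ← map_mul]; norm_num
  refine ⟨c + 1 / 4, by positivity, ?_, ?_⟩
  · convert hQ.add_mem h (hQ.sq_mem (a + algebraMap ℝ A (1 / 2))) using 1
    rw [e]; linear_combination (-a) * e2
  · convert hQ.add_mem h (hQ.sq_mem (a - algebraMap ℝ A (1 / 2))) using 1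
    rw [e]; linear_combination a * e2

end IsQuadraticModule

/-! ### Coordinate projections and polynomial approximation -/

/-- The projection of `ℝⁿ` onto the coordinates in `S`, viewed as an endomorphism of `ℝⁿ` that sets
the remaining coordinates to `0`. -/
def coordProj {n : ℕ} (S : Finset (Fin n)) (x : Fin n → ℝ) : Fin n → ℝ :=
  fun i => if i ∈ S then x i else 0

theorem continuous_coordProj {n : ℕ} (S : Finset (Fin n)) : Continuous (coordProj S) := by
  refine continuous_pi fun i => ?_
  by_cases h : i ∈ S
  · simpa [coordProj, h] using continuous_apply i
  · simpa [coordProj, h] using continuous_const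

theorem coordProj_coordProj {n : ℕ} {S T : Finset (Fin n)} (h : S ⊆ T) (x : Fin n → ℝ) :
    coordProj S (coordProj T x) = coordProj S x := by
  funext i
  by_cases hi : i ∈ S
  · simp [coordProj, hi, h hi]
  · simp [coordProj, hi]

theorem coordProj_eq_self {n : ℕ} {S : Finset (Fin n)} {x : Fin n → ℝ} :
    coordProj S x = x ↔ ∀ i ∉ S, x i = 0 := by
  simp only [funext_iff, coordProj, ite_eq_left_iff, eq_comm (a := (0 : ℝ))]

/-- Setting the variables outside `S` to `0` gives a retraction of `ℝ[x]` onto `ℝ[x(S)]`. -/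
noncomputable def truncate {n : ℕ} (S : Finset (Fin n)) (p : MvPolynomial (Fin n) ℝ) :
    MvPolynomial (Fin n) ℝ :=
  aeval (fun i => if i ∈ S then X i else 0) p

theorem truncate_mem {n : ℕ} (S : Finset (Fin n)) (p : MvPolynomial (Fin n) ℝ) :
    truncate S p ∈ xRing S := by
  rw [truncate, aeval_def, eval₂_eq']
  refine sum_mem fun d _ => mul_mem (Subalgebra.algebraMap_mem _ _)
    (prod_mem fun i _ => pow_mem ?_ _)
  split_ifs with h
  · exact X_mem_supported.2 h
  · exact zero_mem _

theorem eval_truncate {n : ℕ} (S : Finset (Fin n)) (p : MvPolynomial (Fin n) ℝ) (x : Fin n → ℝ) :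
    eval x (truncate S p) = eval (coordProj S x) p := by
  have h : (eval x).comp
      (aeval (R := ℝ) fun i => if i ∈ S then (X i : MvPolynomial (Fin n) ℝ) else 0).toRingHom =
      eval (coordProj S x) := by
    ext i
    · simp
    · by_cases hi : i ∈ S <;> simp [coordProj, hi]
  exact DFunLike.congr_fun h p

theorem eval_eq_of_mem_supported {σ : Type*} {s : Set σ} {p : MvPolynomial σ ℝ}
    (hp : p ∈ supported ℝ s) {x y : σ → ℝ} (h : ∀ i ∈ s, x i = y i) : eval x p = eval y p := by
  refine eval₂Hom_congr' rfl (fun i hi _ => h i ?_) rfl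
  exact mem_supported.1 hp hi

theorem mem_xRing_iff {n : ℕ} {S : Finset (Fin n)} {p : MvPolynomial (Fin n) ℝ} :
    p ∈ xRing S ↔ ∀ x, eval (coordProj S x) p = eval x p := by
  refine ⟨fun hp x => eval_eq_of_mem_supported hp fun i hi => ?_, fun h => ?_⟩
  · exact if_pos hi
  · have : truncate S p = p := MvPolynomial.funext fun x => by rw [eval_truncate, h]
    exact this ▸ truncate_mem S p

/-- Weierstrass approximation by polynomials in several variables on a compact set. -/
theorem exists_eval_near {ι : Type*} (f : C(ι → ℝ, ℝ)) {K : Set (ι → ℝ)}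
    (hK : IsCompact K) {ε : ℝ} (hε : 0 < ε) :
    ∃ p : MvPolynomial ι ℝ, ∀ x ∈ K, |eval x p - f x| < ε := by
  let A : Subalgebra ℝ C(ι → ℝ, ℝ) :=
    (aeval fun i => (⟨fun x => x i, continuous_apply i⟩ : C(ι → ℝ, ℝ))).range
  have hA : ∀ (p : MvPolynomial ι ℝ) (x : ι → ℝ),
      (aeval fun i => (⟨fun x => x i, continuous_apply i⟩ : C(ι → ℝ, ℝ))) p x = eval x p := by
    intro p x
    induction p using MvPolynomial.induction_on with
    | C a => simp
    | add p q hp hq => simp [hp, hq]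
    | mul_X p i hp => simp [hp]
  have hsep : A.SeparatesPoints := by
    intro x y hxy
    obtain ⟨i, hi⟩ := Function.ne_iff.1 hxy
    refine ⟨_, ⟨_, ⟨X i, rfl⟩, rfl⟩, ?_⟩
    simpa using hi
  obtain ⟨_, ⟨p, rfl⟩, hp⟩ :=
    ContinuousMap.exists_mem_subalgebra_near_continuous_of_isCompact_of_separatesPoints hsep f hK hε
  refine ⟨p, fun x hx => ?_⟩
  have := hp x hx
  rw [Real.norm_eq_abs] at this
  rw [← hA p x]
  exact this

/-! ### Splitting a positive sum along the running intersection property -/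

/-- Continuous insertion over a base: if `g < f` holds fibrewise for functions on compact sets `K₂`
and `K₁` over `E`, then a continuous function on `E` separates them. -/
theorem exists_continuous_between {X E : Type*} [TopologicalSpace X] [TopologicalSpace E]
    [T2Space E] [NormalSpace E] [ParacompactSpace E] {K₁ K₂ : Set X} (hK₁ : IsCompact K₁)
    (hK₂ : IsCompact K₂) {π : X → E} (hπ : Continuous π) {f g : X → ℝ} (hf : Continuous f)
    (hg : Continuous g) (h : ∀ x ∈ K₁, ∀ z ∈ K₂, π x = π z → g z < f x) :
    ∃ φ : C(E, ℝ), (∀ x ∈ K₁, φ (π x) < f x) ∧ ∀ z ∈ K₂, g z < φ (π z) := by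
  let T : E → Set ℝ := fun y =>
    {c | (∀ x ∈ K₁, π x = y → c < f x) ∧ ∀ z ∈ K₂, π z = y → g z < c}
  have hT : ∀ y, Convex ℝ (T y) := fun y => Set.OrdConnected.convex ⟨fun a ha b hb c hc =>
    ⟨fun x hx e => hc.2.trans_lt (hb.1 x hx e), fun z hz e => (ha.2 z hz e).trans_le hc.1⟩⟩
  suffices H : ∀ y, ∃ c : ℝ, ∀ᶠ y' in nhds y, c ∈ T y' by
    obtain ⟨φ, hφ⟩ := exists_continuous_forall_mem_convex_of_local_const hT H
    exact ⟨φ, fun x hx => (hφ _).1 x hx rfl, fun z hz => (hφ _).2 z hz rfl⟩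
  intro y
  have hy : IsClosed (π ⁻¹' {y}) := isClosed_singleton.preimage hπ
  have hF₁ : IsCompact (K₁ ∩ π ⁻¹' {y}) := hK₁.inter_right hy
  have hF₂ : IsCompact (K₂ ∩ π ⁻¹' {y}) := hK₂.inter_right hy
  obtain ⟨c, hc₁, hc₂⟩ : ∃ c, (∀ x ∈ K₁ ∩ π ⁻¹' {y}, c < f x) ∧
      ∀ z ∈ K₂ ∩ π ⁻¹' {y}, g z < c := by
    rcases (K₁ ∩ π ⁻¹' {y}).eq_empty_or_nonempty with h₁ | h₁
    · obtain ⟨b, hb⟩ := hF₂.bddAbove_image hg.continuousOn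
      refine ⟨b + 1, by simp [h₁], fun z hz => ?_⟩
      linarith [hb (Set.mem_image_of_mem g hz)]
    rcases (K₂ ∩ π ⁻¹' {y}).eq_empty_or_nonempty with h₂ | h₂
    · obtain ⟨b, hb⟩ := hF₁.bddBelow_image hf.continuousOn
      refine ⟨b - 1, fun x hx => ?_, by simp [h₂]⟩
      linarith [hb (Set.mem_image_of_mem f hx)]
    obtain ⟨x, hx, hmin⟩ := hF₁.exists_isMinOn h₁ hf.continuousOn
    obtain ⟨z, hz, hmax⟩ := hF₂.exists_isMaxOn h₂ hg.continuousOn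
    obtain ⟨c, hc⟩ := exists_between (h x hx.1 z hz.1 (hx.2.trans hz.2.symm))
    exact ⟨c, fun x' hx' => hc.2.trans_le (hmin hx'), fun z' hz' => (hmax hz').trans_lt hc.1⟩
  have hB₁ : IsClosed (π '' (K₁ ∩ {x | f x ≤ c})) :=
    ((hK₁.inter_right (isClosed_le hf continuous_const)).image hπ).isClosed
  have hB₂ : IsClosed (π '' (K₂ ∩ {z | c ≤ g z})) :=
    ((hK₂.inter_right (isClosed_le continuous_const hg)).image hπ).isClosed
  -- The constant `c` works near `y`: the projections of the bad sets are closed and miss `y`.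
  have hy₁ : y ∉ π '' (K₁ ∩ {x | f x ≤ c}) := by
    rintro ⟨x, ⟨hx, hle⟩, e⟩
    exact (hc₁ x ⟨hx, e⟩).not_ge hle
  have hy₂ : y ∉ π '' (K₂ ∩ {z | c ≤ g z}) := by
    rintro ⟨z, ⟨hz, hle⟩, e⟩
    exact (hc₂ z ⟨hz, e⟩).not_ge hle
  refine ⟨c, ?_⟩
  filter_upwards [hB₁.isOpen_compl.mem_nhds hy₁, hB₂.isOpen_compl.mem_nhds hy₂] with y' h₁ h₂
  exact ⟨fun x hx e => not_le.1 fun hle => h₁ ⟨x, ⟨hx, hle⟩, e⟩, fun z hz e =>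
    not_le.1 fun hle => h₂ ⟨z, ⟨hz, hle⟩, e⟩⟩

/-- The two-block case: a polynomial in the shared variables can be moved from one summand to the
other so that both become positive. -/
theorem exists_polynomial_between {n : ℕ} {S : Finset (Fin n)} {K₁ K₂ : Set (Fin n → ℝ)}
    (hK₁ : IsCompact K₁) (hK₂ : IsCompact K₂) (f₁ f₂ : MvPolynomial (Fin n) ℝ)
    (h : ∀ x ∈ K₁, ∀ z ∈ K₂, coordProj S x = coordProj S z → 0 < eval x f₁ + eval z f₂) :
    ∃ p ∈ xRing S, (∀ x ∈ K₁, 0 < eval x (f₁ - p)) ∧ ∀ z ∈ K₂, 0 < eval z (f₂ + p) := by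
  have hπ := continuous_coordProj S
  obtain ⟨φ, hφ₁, hφ₂⟩ := exists_continuous_between hK₁ hK₂ hπ
    (f := fun x => eval x f₁) (g := fun z => -eval z f₂) (MvPolynomial.continuous_eval f₁)
    (MvPolynomial.continuous_eval f₂).neg (fun x hx z hz e => by linarith [h x hx z hz e])
  obtain ⟨δ₁, hδ₁, h₁⟩ := hK₁.exists_forall_le' (f := fun x => eval x f₁ - φ (coordProj S x))
    (a := 0) ((MvPolynomial.continuous_eval f₁).sub (φ.continuous.comp hπ)).continuousOn
    (fun x hx => sub_pos.2 (hφ₁ x hx))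
  obtain ⟨δ₂, hδ₂, h₂⟩ := hK₂.exists_forall_le' (f := fun z => eval z f₂ + φ (coordProj S z))
    (a := 0) ((MvPolynomial.continuous_eval f₂).add (φ.continuous.comp hπ)).continuousOn
    (fun z hz => by linarith [hφ₂ z hz])
  obtain ⟨p, hp⟩ := exists_eval_near φ ((hK₁.union hK₂).image hπ) (lt_min hδ₁ hδ₂)
  refine ⟨truncate S p, truncate_mem S p, fun x hx => ?_, fun z hz => ?_⟩
  · have a := h₁ x hx
    have b := (abs_lt.1 (hp _ (Set.mem_image_of_mem _ (Or.inl hx)))).2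
    have c := min_le_left δ₁ δ₂
    simp only [map_sub, eval_truncate]
    linarith
  · have a := h₂ z hz
    have b := (abs_lt.1 (hp _ (Set.mem_image_of_mem _ (Or.inr hz)))).1
    have c := min_le_right δ₁ δ₂
    simp only [map_add, eval_truncate]
    linarith

theorem isCompact_forall_coordProj_mem {n t : ℕ} (I : Fin t → Finset (Fin n))
    {K : Fin t → Set (Fin n → ℝ)} (hK : ∀ ℓ, IsCompact (K ℓ)) :
    IsCompact {x | coordProj (Finset.univ.biUnion I) x = x ∧ ∀ ℓ, coordProj (I ℓ) x ∈ K ℓ} := by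
  obtain ⟨R, hR⟩ := (isCompact_iUnion hK).isBounded.exists_norm_le
  refine Metric.isCompact_of_isClosed_isBounded ?_ ?_
  · refine IsClosed.inter (isClosed_eq (continuous_coordProj _) continuous_id) ?_
    change IsClosed {x | ∀ ℓ, coordProj (I ℓ) x ∈ K ℓ}
    rw [show {x | ∀ ℓ, coordProj (I ℓ) x ∈ K ℓ} = ⋂ ℓ, coordProj (I ℓ) ⁻¹' K ℓ by ext; simp]
    exact isClosed_iInter fun ℓ => (hK ℓ).isClosed.preimage (continuous_coordProj (I ℓ))
  · refine isBounded_iff_forall_norm_le.2 ⟨max R 0, fun x hx => ?_⟩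
    refine (pi_norm_le_iff_of_nonneg (le_max_right _ _)).2 fun i => ?_
    by_cases hi : ∃ ℓ, i ∈ I ℓ
    · obtain ⟨ℓ, hℓ⟩ := hi
      have h := (norm_le_pi_norm _ i).trans (hR _ (Set.mem_iUnion_of_mem ℓ (hx.2 ℓ)))
      simp only [coordProj, hℓ, if_true] at h
      exact h.trans (le_max_left _ _)
    · rw [coordProj_eq_self.1 hx.1 i (by simpa using hi), norm_zero]
      exact le_max_right _ _

/-- Under the running intersection property, a sum of polynomials in the blocks `x(I_ℓ)` which is
positive on the common feasible set can be rearranged so that every summand is positive on the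
feasible set of its own block. Each `K ℓ` lives in `ℝⁿ`, with coordinates outside `I ℓ` equal to
`0`. -/
theorem exists_blockwise_pos {n t : ℕ} (I : Fin t → Finset (Fin n)) (rip : RunningIntersection I)
    (K : Fin t → Set (Fin n → ℝ)) (hK : ∀ ℓ, IsCompact (K ℓ))
    (hKI : ∀ ℓ, ∀ x ∈ K ℓ, coordProj (I ℓ) x = x)
    (F : Fin t → MvPolynomial (Fin n) ℝ) (hF : ∀ ℓ, F ℓ ∈ xRing (I ℓ))
    (hpos : ∀ x, (∀ ℓ, coordProj (I ℓ) x ∈ K ℓ) → 0 < eval x (∑ ℓ, F ℓ)) :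
    ∃ g : Fin t → MvPolynomial (Fin n) ℝ, (∀ ℓ, g ℓ ∈ xRing (I ℓ)) ∧ ∑ ℓ, g ℓ = ∑ ℓ, F ℓ ∧
      ∀ ℓ, ∀ x ∈ K ℓ, 0 < eval x (g ℓ) := by
  induction t with
  | zero => exact ⟨F, hF, rfl, fun ℓ => ℓ.elim0⟩
  | succ t ih =>
    rcases Nat.eq_zero_or_pos t with rfl | ht
    · refine ⟨F, hF, rfl, fun ℓ x hx => ?_⟩
      obtain rfl := Fin.fin_one_eq_zero ℓ
      simpa using hpos x fun ℓ => by
        obtain rfl := Fin.fin_one_eq_zero ℓ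
        rwa [hKI 0 x hx]
    set I' : Fin t → Finset (Fin n) := fun ℓ => I ℓ.castSucc with hI'
    set U : Finset (Fin n) := Finset.univ.biUnion I' with hU
    have hIU : ∀ ℓ, I' ℓ ⊆ U := fun ℓ => Finset.subset_biUnion_of_mem I' (Finset.mem_univ ℓ)
    have hbi : ∀ ℓ : Fin t, (Finset.Iio ℓ).biUnion I' = (Finset.Iio ℓ.castSucc).biUnion I := by
      intro ℓ
      ext i
      simp only [Finset.mem_biUnion, Finset.mem_Iio]
      constructor
      · rintro ⟨j, hj, hi⟩
        exact ⟨j.castSucc, hj, hi⟩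
      · rintro ⟨j, hj, hi⟩
        obtain ⟨j, rfl⟩ := Fin.exists_castSucc_eq.2 (hj.trans (Fin.castSucc_lt_last ℓ)).ne
        exact ⟨j, hj, hi⟩
    have rip' : RunningIntersection I' := by
      intro ℓ hℓ
      obtain ⟨k, hk, hsub⟩ := rip ℓ.castSucc hℓ
      obtain ⟨k, rfl⟩ := Fin.exists_castSucc_eq.2 (hk.trans (Fin.castSucc_lt_last ℓ)).ne
      exact ⟨k, hk, (hbi ℓ).symm ▸ hsub⟩
    set S := I (Fin.last t) ∩ U with hS
    obtain ⟨k, hk⟩ : ∃ k, S ⊆ I' k := by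
      obtain ⟨k, hk, hsub⟩ := rip (Fin.last t) ht
      obtain ⟨k, rfl⟩ := Fin.exists_castSucc_eq.2 hk.ne
      refine ⟨k, fun i hi => hsub ?_⟩
      obtain ⟨hi₁, hi₂⟩ := Finset.mem_inter.1 hi
      obtain ⟨ℓ, -, hℓ⟩ := Finset.mem_biUnion.1 hi₂
      exact Finset.mem_inter.2 ⟨hi₁, Finset.mem_biUnion.2
        ⟨ℓ.castSucc, Finset.mem_Iio.2 (Fin.castSucc_lt_last ℓ), hℓ⟩⟩
    have hsumU : ∑ ℓ : Fin t, F ℓ.castSucc ∈ xRing U := sum_mem fun ℓ _ =>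
      supported_mono (Finset.coe_subset.2 (hIU ℓ)) (hF ℓ.castSucc)
    obtain ⟨p, hpS, hp₁, hp₂⟩ := exists_polynomial_between (S := S)
      (isCompact_forall_coordProj_mem I' fun ℓ => hK ℓ.castSucc) (hK (Fin.last t))
      (∑ ℓ : Fin t, F ℓ.castSucc) (F (Fin.last t)) (by
        rintro x ⟨hxU, hxK⟩ z hz e
        -- `x` and `z` agree on the shared variables, so they glue to a common point `w`.
        set w : Fin n → ℝ := fun i => if i ∈ U then x i else z i with hw
        have hwU : ∀ i ∈ U, w i = x i := fun i hi => if_pos hi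
        have hwz : ∀ i ∈ I (Fin.last t), w i = z i := fun i hi => by
          by_cases hiU : i ∈ U
          · have := congrFun e i
            simpa [coordProj, hS, hi, hiU, hw] using this
          · exact if_neg hiU
        have := hpos w fun ℓ => by
          refine Fin.lastCases ?_ (fun ℓ => ?_) ℓ
          · have : coordProj (I (Fin.last t)) w = coordProj (I (Fin.last t)) z := by
              funext i
              simp only [coordProj]
              split_ifs with hi
              exacts [hwz i hi, rfl]
            rw [this, hKI _ z hz]
            exact hz
          · have : coordProj (I ℓ.castSucc) w = coordProj (I' ℓ) x := by
              funext i
              simp only [coordProj]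
              split_ifs with hi
              exacts [hwU i (hIU ℓ hi), rfl]
            rw [this]
            exact hxK ℓ
        rwa [Fin.sum_univ_castSucc, map_add, eval_eq_of_mem_supported hsumU hwU,
          eval_eq_of_mem_supported (hF (Fin.last t)) hwz] at this)
    -- The polynomial `p` is absorbed by block `k`, whose variables include all those of `p`.
    set F' : Fin t → MvPolynomial (Fin n) ℝ :=
      fun ℓ => F ℓ.castSucc - if ℓ = k then p else 0 with hF'
    have hsum' : ∑ ℓ, F' ℓ = ∑ ℓ : Fin t, F ℓ.castSucc - p := by
      simp [hF', Finset.sum_sub_distrib]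
    have hpk : p ∈ xRing (I' k) := supported_mono (Finset.coe_subset.2 hk) hpS
    have hpU : p ∈ xRing U := supported_mono (Finset.coe_subset.2 (hIU k)) hpk
    obtain ⟨g, hg, hgsum, hgpos⟩ := ih I' rip' (fun ℓ => K ℓ.castSucc) (fun ℓ => hK ℓ.castSucc)
      (fun ℓ => hKI ℓ.castSucc) F' (fun ℓ => by
        refine sub_mem (hF ℓ.castSucc) ?_
        split_ifs with h
        · exact h ▸ hpk
        · exact zero_mem _) (fun x hx => by
        rw [hsum', ← mem_xRing_iff.1 (sub_mem hsumU hpU)]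
        exact hp₁ _ ⟨coordProj_coordProj subset_rfl x, fun ℓ => by
          rw [coordProj_coordProj (hIU ℓ)]; exact hx ℓ⟩)
    refine ⟨Fin.snoc (α := fun _ => MvPolynomial (Fin n) ℝ) g (F (Fin.last t) + p), fun ℓ => ?_, ?_,
      fun ℓ => ?_⟩
    · refine Fin.lastCases ?_ (fun ℓ => ?_) ℓ
      · rw [Fin.snoc_last]
        exact add_mem (hF _)
          (supported_mono (Finset.coe_subset.2 Finset.inter_subset_left) hpS)
      · rw [Fin.snoc_castSucc]
        exact hg ℓ
    · rw [Fin.sum_univ_castSucc, Fin.sum_univ_castSucc (f := F)]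
      simp only [Fin.snoc_castSucc, Fin.snoc_last, hgsum, hsum']
      ring
    · refine Fin.lastCases ?_ (fun ℓ => ?_) ℓ
      · rw [Fin.snoc_last]
        exact hp₂
      · rw [Fin.snoc_castSucc]
        exact hgpos ℓ

/-! ### Characters and boundedness in `ℝ[x(I)]` -/

/-- Every real character of `ℝ[x(I)]` is evaluation at a point with coordinates `0` outside `I`. -/
theorem exists_eval_of_algHom {n : ℕ} {I : Finset (Fin n)} (φ : xRing I →ₐ[ℝ] ℝ) :
    ∃ x : Fin n → ℝ, coordProj I x = x ∧
      ∀ a : xRing I, φ a = eval x (a : MvPolynomial (Fin n) ℝ) := by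
  classical
  set x : Fin n → ℝ := fun i => if h : i ∈ I then φ ⟨X i, X_mem_supported.2 h⟩ else 0 with hx
  refine ⟨x, coordProj_eq_self.2 fun i hi => dif_neg hi, ?_⟩
  rintro ⟨a, ha⟩
  induction ha using Algebra.adjoin_induction with
  | mem a h =>
    obtain ⟨i, hi, rfl⟩ := h
    change φ ⟨X i, _⟩ = eval x (X i)
    simp [hx, Finset.mem_coe.1 hi]
  | algebraMap r =>
    change _ = eval x (C r)
    rw [eval_C]
    exact φ.commutes r
  | add a b ha hb iha ihb =>
    rw [map_add, ← iha, ← ihb, ← map_add]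
    rfl
  | mul a b ha hb iha ihb =>
    rw [map_mul, ← iha, ← ihb, ← map_mul]
    rfl

/-- A quadratic module of `ℝ[x(I)]` containing `c - ∑ i ∈ I, x_i²` bounds every polynomial. -/
theorem exists_algebraMap_sub_mem {n : ℕ} {I : Finset (Fin n)} {Q : Set (xRing I)}
    (hQ : IsQuadraticModule Q) {c : ℝ} (hc : 0 < c) {b : xRing I} (hb : b ∈ Q)
    (e : (b : MvPolynomial (Fin n) ℝ) = C c - ∑ i ∈ I, X i ^ 2) (a : xRing I) :
    ∃ r : ℝ, algebraMap ℝ (xRing I) r - a ∈ Q := by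
  have hX : ∀ i (hi : i ∈ I), (⟨X i, X_mem_supported.2 hi⟩ : xRing I) ∈ hQ.boundedSubalgebra := by
    intro i hi
    refine hQ.mem_boundedSubalgebra_of_sq hc ?_
    have hsum : (∑ j ∈ (I.erase i).attach,
        (⟨X j, X_mem_supported.2 (Finset.mem_of_mem_erase j.2)⟩ : xRing I) ^ 2) ∈ Q :=
      hQ.sum_mem fun j _ => hQ.sq_mem _
    convert hQ.add_mem hb hsum using 1
    apply Subtype.ext
    simp only [AddMemClass.coe_add, AddSubgroupClass.coe_sub, e, AddSubmonoidClass.coe_finsetSum,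
      SubmonoidClass.coe_pow,
      Finset.sum_attach (I.erase i) fun j => (X j : MvPolynomial (Fin n) ℝ) ^ 2]
    rw [← Finset.add_sum_erase I _ hi]
    change C c - X i ^ 2 = _
    ring
  have hle : xRing I ≤ hQ.boundedSubalgebra.map (xRing I).val := by
    refine Algebra.adjoin_le ?_
    rintro _ ⟨i, hi, rfl⟩
    exact ⟨_, hX i hi, rfl⟩
  obtain ⟨a', ⟨r, -, -, hr⟩, e'⟩ := hle a.2
  obtain rfl : a' = a := Subtype.ext e'
  exact ⟨r, hr⟩

/-! ### Integration over `Y` -/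

section Integration

variable {n m : ℕ} {ν : Measure (Fin m → ℝ)} {Y : Set (Fin m → ℝ)}

theorem eval_asPolyInY (h : MvPolynomial (Fin n ⊕ Fin m) ℝ) (x : Fin n → ℝ) (y : Fin m → ℝ) :
    eval y (map (eval x) (asPolyInY h)) = eval (Sum.elim x y) h := by
  have key : ((eval y).comp (map (eval x))).comp
      ((sumAlgEquiv ℝ (Fin m) (Fin n)).toRingEquiv.toRingHom.comp
        (rename (R := ℝ) Sum.swap).toRingHom) = eval (Sum.elim x y) := by
    ext i
    · simp
    · rcases i with i | i <;> simp
  exact DFunLike.congr_fun key h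

theorem integrableOn_eval
    (hmom : ∀ h : MvPolynomial (Fin m) ℝ, IntegrableOn (fun y => eval y h) Y ν)
    (h : MvPolynomial (Fin n ⊕ Fin m) ℝ) (x : Fin n → ℝ) :
    IntegrableOn (fun y => eval (Sum.elim x y) h) Y ν := by
  simpa only [eval_asPolyInY] using hmom (map (eval x) (asPolyInY h))

theorem eval_integralY
    (hmom : ∀ h : MvPolynomial (Fin m) ℝ, IntegrableOn (fun y => eval y h) Y ν)
    (h : MvPolynomial (Fin n ⊕ Fin m) ℝ) (x : Fin n → ℝ) :
    eval x (integralY ν Y h) = ∫ y in Y, eval (Sum.elim x y) h ∂ν := by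
  have hmono : ∀ β : Fin m →₀ ℕ, IntegrableOn (fun y : Fin m → ℝ => ∏ j, y j ^ β j) Y ν :=
    fun β => by simpa [eval_monomial, Finsupp.prod_fintype] using hmom (monomial β 1)
  simp only [← eval_asPolyInY h x, eval_map, eval₂_eq']
  rw [integral_finsetSum _ fun β _ => (hmono β).const_mul _, integralY, map_sum]
  refine Finset.sum_congr rfl fun β _ => ?_
  rw [integral_const_mul, map_mul, eval_C]

theorem integralY_add
    (hmom : ∀ h : MvPolynomial (Fin m) ℝ, IntegrableOn (fun y => eval y h) Y ν)
    (h h' : MvPolynomial (Fin n ⊕ Fin m) ℝ) :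
    integralY ν Y (h + h') = integralY ν Y h + integralY ν Y h' :=
  MvPolynomial.funext fun x => by
    simp only [map_add, eval_integralY hmom]
    exact integral_add (integrableOn_eval hmom h x) (integrableOn_eval hmom h' x)

theorem integralY_rename_mul
    (hmom : ∀ h : MvPolynomial (Fin m) ℝ, IntegrableOn (fun y => eval y h) Y ν)
    (a : MvPolynomial (Fin n) ℝ) (h : MvPolynomial (Fin n ⊕ Fin m) ℝ) :
    integralY ν Y (rename Sum.inl a * h) = a * integralY ν Y h :=
  MvPolynomial.funext fun x => by
    simp only [map_mul, eval_integralY hmom, eval_rename, Sum.elim_comp_inl]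
    exact integral_const_mul _ _

theorem integralY_zero : integralY ν Y (0 : MvPolynomial (Fin n ⊕ Fin m) ℝ) = 0 := by
  simp [integralY, asPolyInY]

theorem integralY_mem_xRing
    (hmom : ∀ h : MvPolynomial (Fin m) ℝ, IntegrableOn (fun y => eval y h) Y ν)
    {I : Finset (Fin n)} {h : MvPolynomial (Fin n ⊕ Fin m) ℝ} (hh : h ∈ xyRing m I) :
    integralY ν Y h ∈ xRing I := by
  refine mem_xRing_iff.2 fun x => ?_
  simp only [eval_integralY hmom]
  congr 1
  funext y
  refine eval_eq_of_mem_supported hh ?_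
  rintro _ (⟨i, hi, rfl⟩ | ⟨i, rfl⟩)
  · exact if_pos hi
  · rfl

theorem rename_inl_mem_xyRing {I : Finset (Fin n)} {a : MvPolynomial (Fin n) ℝ}
    (ha : a ∈ xRing I) : rename Sum.inl a ∈ xyRing m I := by
  classical
  refine mem_supported.2 fun i hi => ?_
  obtain ⟨j, hj, rfl⟩ := Finset.mem_image.1 (vars_rename _ _ hi)
  exact Or.inl ⟨j, mem_supported.1 ha hj, rfl⟩

theorem rename_inr_mem_xyRing (I : Finset (Fin n)) (p : MvPolynomial (Fin m) ℝ) :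
    rename Sum.inr p ∈ xyRing m I := by
  classical
  refine mem_supported.2 fun i hi => ?_
  obtain ⟨j, -, rfl⟩ := Finset.mem_image.1 (vars_rename _ _ hi)
  exact Or.inr ⟨j, rfl⟩

/-- A continuous function whose integral against the square of every polynomial is nonnegative is
nonnegative on the (compact) support of the measure. -/
theorem nonneg_of_integral_sq_mul_nonneg (hY : IsCompact Y) (hsupp : ν.support = Y)
    (hfin : ν Y ≠ ⊤) {u : (Fin m → ℝ) → ℝ} (hu : Continuous u)
    (h : ∀ p : MvPolynomial (Fin m) ℝ, 0 ≤ ∫ y in Y, (eval y p) ^ 2 * u y ∂ν) :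
    ∀ y ∈ Y, 0 ≤ u y := by
  intro y₀ hy₀
  by_contra! hneg
  have : IsFiniteMeasure (ν.restrict Y) := ⟨by simpa using hfin.lt_top⟩
  have hint : ∀ {f : (Fin m → ℝ) → ℝ}, Continuous f → IntegrableOn f Y ν := fun {f} hf => by
    have := hf.continuousOn.integrableOn_compact (μ := ν.restrict Y) hY
    rwa [IntegrableOn, Measure.restrict_restrict hY.measurableSet, Set.inter_self] at this
  -- The test function `φ²` with `φ = max (-u) 0` detects the set where `u < 0`.
  set φ : C(Fin m → ℝ, ℝ) := ⟨fun y => max (-u y) 0, hu.neg.max continuous_const⟩ with hφ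
  have hφ0 : ∀ y, 0 ≤ φ y := fun y => le_max_right _ _
  have hφu : ∀ y, φ y ^ 2 * u y = -φ y ^ 3 := by
    intro y
    rcases le_total (-u y) 0 with hle | hle
    · have : φ y = 0 := max_eq_right hle
      simp [this]
    · have : φ y = -u y := max_eq_left hle
      rw [this]; ring
  have hpos : 0 < ∫ y in Y, φ y ^ 3 ∂ν := by
    rw [integral_pos_iff_support_of_nonneg (fun y => pow_nonneg (hφ0 y) 3)
      (hint (φ.continuous.pow 3))]
    have hW : {y | u y < 0} ∈ nhds y₀ := (isOpen_lt hu continuous_const).mem_nhds hneg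
    have h0 : 0 < ν {y | u y < 0} :=
      (Measure.mem_support_iff_forall _).1 (hsupp ▸ hy₀) _ hW
    have hYc : ν Yᶜ = 0 := hsupp ▸ Measure.measure_compl_support
    refine h0.trans_le ?_
    rw [Measure.restrict_apply' hY.measurableSet, measure_inter_conull hYc]
    refine measure_mono fun y hy => ?_
    have : φ y = -u y := max_eq_left (neg_nonneg.2 (le_of_lt hy))
    rw [Function.mem_support, this]
    exact pow_ne_zero 3 (neg_ne_zero.2 (ne_of_lt hy))
  set η := ∫ y in Y, φ y ^ 3 ∂ν with hη
  obtain ⟨M, hM⟩ := hY.exists_bound_of_continuousOn hu.continuousOn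
  have hM0 : 0 ≤ M := (norm_nonneg _).trans (hM y₀ hy₀)
  have hφM : ∀ y ∈ Y, φ y ≤ M := fun y hy =>
    max_le ((neg_le_abs _).trans (hM y hy)) hM0
  set B := (2 * M + 1) * M * ν.real Y with hB
  have hB0 : 0 ≤ B := by positivity
  obtain ⟨p, hp⟩ := exists_eval_near φ hY (ε := min 1 (η / (B + 1))) (by positivity)
  set ε := min 1 (η / (B + 1)) with hε
  have hε1 : ε ≤ 1 := min_le_left _ _
  have hε0 : 0 < ε := by positivity
  have hbound : ∀ y ∈ Y, (eval y p) ^ 2 * u y ≤ -φ y ^ 3 + ε * ((2 * M + 1) * M) := by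
    intro y hy
    have h1 := hp y hy
    have h2 : |eval y p + φ y| ≤ 2 * M + 1 := by
      have := abs_add_le (eval y p - φ y) (2 * φ y)
      rw [abs_of_nonneg (by linarith [hφ0 y] : (0 : ℝ) ≤ 2 * φ y)] at this
      rw [show eval y p + φ y = eval y p - φ y + 2 * φ y by ring]
      linarith [hφM y hy]
    have h3 : ((eval y p) ^ 2 - φ y ^ 2) * u y ≤ ε * ((2 * M + 1) * M) := by
      refine (le_abs_self _).trans ?_
      rw [show ((eval y p) ^ 2 - φ y ^ 2) * u y =
        (eval y p - φ y) * ((eval y p + φ y) * u y) by ring, abs_mul, abs_mul]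
      have h4 := hM y hy
      rw [Real.norm_eq_abs] at h4
      gcongr
    linarith [hφu y]
  have hle := setIntegral_mono_on (f := fun y => (eval y p) ^ 2 * u y)
    (g := fun y => -φ y ^ 3 + ε * ((2 * M + 1) * M))
    (hint ((MvPolynomial.continuous_eval p).pow 2 |>.mul hu))
    (hint ((φ.continuous.pow 3).neg.add continuous_const)) hY.measurableSet hbound
  rw [integral_add (hint (f := fun y => -φ y ^ 3) (φ.continuous.pow 3).neg)
    (hint continuous_const), integral_neg,
    setIntegral_const, smul_eq_mul] at hle
  have h5 := h p
  have h6 : ε * (B + 1) ≤ η := by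
    rw [← le_div_iff₀ (by positivity)]
    exact min_le_right _ _
  have h7 : ν.real Y * (ε * ((2 * M + 1) * M)) = ε * B := by rw [hB]; ring
  rw [h7] at hle
  have h8 : (∫ y in Y, φ y ^ 3 ∂ν) = η := rfl
  linarith

end Integration

/-! ### The quadratic modules attached to matrix constraints -/

section QuadModule

theorem IsSOS.add {R : Type*} [CommRing R] [Algebra ℝ R] {A : Subalgebra ℝ R} {σ τ : R}
    (hσ : IsSOS A σ) (hτ : IsSOS A τ) : IsSOS A (σ + τ) := by
  obtain ⟨l, g, hg, rfl⟩ := hσ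
  obtain ⟨l', g', hg', rfl⟩ := hτ
  refine ⟨l + l', Fin.append g g', fun i => ?_, by simp [Fin.sum_univ_add]⟩
  refine Fin.addCases (fun i => ?_) (fun i => ?_) i
  · simpa using hg i
  · simpa using hg' i

theorem IsSOS.sq_mul {R : Type*} [CommRing R] [Algebra ℝ R] {A : Subalgebra ℝ R} {a σ : R}
    (ha : a ∈ A) (hσ : IsSOS A σ) : IsSOS A (a ^ 2 * σ) := by
  obtain ⟨l, g, hg, rfl⟩ := hσ
  exact ⟨l, fun i => a * g i, fun i => mul_mem ha (hg i), by simp [Finset.mul_sum, mul_pow]⟩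

theorem isSOSMatrix_zero {R : Type*} [CommRing R] [Algebra ℝ R] (A : Subalgebra ℝ R) {q : ℕ} :
    IsSOSMatrix A (0 : Matrix (Fin q) (Fin q) R) :=
  ⟨0, 0, fun i => i.elim0, by simp⟩

theorem IsSOSMatrix.add {R : Type*} [CommRing R] [Algebra ℝ R] {A : Subalgebra ℝ R} {q : ℕ}
    {S S' : Matrix (Fin q) (Fin q) R} (hS : IsSOSMatrix A S) (hS' : IsSOSMatrix A S') :
    IsSOSMatrix A (S + S') := by
  obtain ⟨l, T, hT, rfl⟩ := hS
  obtain ⟨l', T', hT', rfl⟩ := hS'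
  refine ⟨l + l', Matrix.of fun i k => Fin.append (T · k) (T' · k) i, fun i k => ?_, ?_⟩
  · refine Fin.addCases (fun i => ?_) (fun i => ?_) i
    · simpa using hT i k
    · simpa using hT' i k
  · ext a b
    simp [Matrix.mul_apply, Fin.sum_univ_add]

theorem IsSOSMatrix.sq_smul {R : Type*} [CommRing R] [Algebra ℝ R] {A : Subalgebra ℝ R} {q : ℕ}
    {S : Matrix (Fin q) (Fin q) R} {a : R} (ha : a ∈ A) (hS : IsSOSMatrix A S) :
    IsSOSMatrix A (a ^ 2 • S) := by
  obtain ⟨l, T, hT, rfl⟩ := hS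
  refine ⟨l, a • T, fun i k => mul_mem ha (hT i k), ?_⟩
  rw [Matrix.transpose_smul, Matrix.smul_mul, Matrix.mul_smul, smul_smul, pow_two]

variable {n m s : ℕ} {q : Fin s → ℕ} {ν : Measure (Fin m → ℝ)} {Y : Set (Fin m → ℝ)}
  {G : (j : Fin s) → Matrix (Fin (q j)) (Fin (q j)) (MvPolynomial (Fin n ⊕ Fin m) ℝ)}

theorem isQuadraticModule_quadModule
    (hmom : ∀ h : MvPolynomial (Fin m) ℝ, IntegrableOn (fun y => eval y h) Y ν)
    (I : Finset (Fin n)) (J : Finset (Fin s)) :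
    IsQuadraticModule {a : xRing I | (a : MvPolynomial (Fin n) ℝ) ∈ quadModule ν Y G I J} where
  one_mem := ⟨1, 0, ⟨1, fun _ => 1, fun _ => one_mem _, by simp⟩, fun _ _ => isSOSMatrix_zero _,
    by simp [matInner, integralY_zero]⟩
  add_mem := by
    rintro ⟨_, ha⟩ ⟨_, hb⟩ ⟨σ, S, hσ, hS, rfl⟩ ⟨σ', S', hσ', hS', rfl⟩
    refine ⟨σ + σ', S + S', hσ.add hσ', fun j hj => (hS j hj).add (hS' j hj), ?_⟩
    simp only [Pi.add_apply, matInner, Matrix.transpose_add, Matrix.add_mul, Matrix.trace_add,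
      integralY_add hmom, Finset.sum_add_distrib]
    change _ + _ + (_ + _) = _
    ring
  sq_mul_mem := by
    rintro ⟨a, ha⟩ ⟨_, hb⟩ ⟨σ, S, hσ, hS, rfl⟩
    refine ⟨a ^ 2 * σ, fun j => (rename Sum.inl a) ^ 2 • S j, hσ.sq_mul ha,
      fun j hj => (hS j hj).sq_smul (rename_inl_mem_xyRing ha), ?_⟩
    simp only [matInner, Matrix.transpose_smul, Matrix.smul_mul, Matrix.trace_smul, smul_eq_mul,
      ← map_pow, integralY_rename_mul hmom, ← Finset.mul_sum]
    change a ^ 2 * (_ + _) = _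
    ring

/-- The positivity set of the quadratic module of a block is contained in the set cut out by the
matrix constraints of that block. The test matrices are `p(y)² v vᵀ` with `v` a constant vector. -/
theorem posSemidef_of_quadModule_nonneg (hY : IsCompact Y) (hsupp : ν.support = Y)
    (hmom : ∀ h : MvPolynomial (Fin m) ℝ, IntegrableOn (fun y => eval y h) Y ν)
    (hG : ∀ j, (G j).IsSymm) {I : Finset (Fin n)} {J : Finset (Fin s)}
    (hGI : ∀ j ∈ J, ∀ a b, G j a b ∈ xyRing m I) {x : Fin n → ℝ}
    (hx : ∀ a ∈ xRing I, a ∈ quadModule ν Y G I J → 0 ≤ eval x a) {j : Fin s} (hj : j ∈ J)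
    {y : Fin m → ℝ} (hy : y ∈ Y) : (evalMat (G j) x y).PosSemidef := by
  refine Matrix.posSemidef_iff_dotProduct_mulVec.2 ⟨?_, fun v => ?_⟩
  · rw [Matrix.IsHermitian, Matrix.conjTranspose_eq_transpose_of_trivial]
    exact (hG j).map _
  have hfin : ν Y ≠ ⊤ := by
    have := hmom 1
    simp only [map_one] at this
    rw [integrableOn_const_iff] at this
    simpa [lt_top_iff_ne_top] using this
  have hcont : Continuous fun y => star v ⬝ᵥ (evalMat (G j) x y).mulVec v := by
    simp only [dotProduct, Matrix.mulVec, evalMat, Matrix.map_apply]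
    have : ∀ a b, Continuous fun y : Fin m → ℝ => eval (Sum.elim x y) (G j a b) := fun a b =>
      (MvPolynomial.continuous_eval _).comp (by
        refine continuous_pi fun i => ?_
        rcases i with i | i
        · exact continuous_const
        · exact continuous_apply i)
    fun_prop
  refine nonneg_of_integral_sq_mul_nonneg hY hsupp hfin hcont (fun p => ?_) y hy
  set T : Matrix (Fin 1) (Fin (q j)) (MvPolynomial (Fin n ⊕ Fin m) ℝ) :=
    Matrix.of fun _ k => rename Sum.inr p * C (v k) with hT
  have hTA : ∀ i k, T i k ∈ xyRing m I := fun i k =>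
    mul_mem (rename_inr_mem_xyRing I p) (Subalgebra.algebraMap_mem _ (v k))
  have heval : ∀ y, eval (Sum.elim x y) (matInner (T.transpose * T) (G j)) =
      (eval y p) ^ 2 * (star v ⬝ᵥ (evalMat (G j) x y).mulVec v) := by
    intro y
    simp only [matInner, Matrix.trace, Matrix.diag, Matrix.mul_apply, Matrix.transpose_apply,
      Fin.sum_univ_one, hT, Matrix.of_apply, map_sum, map_mul, eval_rename, Sum.elim_comp_inr,
      eval_C, dotProduct, Matrix.mulVec, evalMat, Matrix.map_apply, Finset.mul_sum, star_trivial]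
    rw [Finset.sum_comm]
    refine Finset.sum_congr rfl fun a _ => Finset.sum_congr rfl fun b _ => ?_
    ring
  have hmemA : matInner (T.transpose * T) (G j) ∈ xyRing m I := by
    simp only [matInner, Matrix.trace, Matrix.diag, Matrix.mul_apply, Matrix.transpose_apply]
    exact sum_mem fun a _ => sum_mem fun b _ =>
      mul_mem (sum_mem fun i _ => mul_mem (hTA _ _) (hTA _ _)) (hGI j hj _ _)
  have := hx (integralY ν Y (matInner (T.transpose * T) (G j))) (integralY_mem_xRing hmom hmemA)
    ⟨0, Function.update (fun _ => 0) j (T.transpose * T), ⟨0, 0, fun i => i.elim0, by simp⟩,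
      fun j' _ => by
        rcases eq_or_ne j' j with rfl | hne
        · rw [Function.update_self]
          exact ⟨1, T, hTA, rfl⟩
        · rw [Function.update_of_ne hne]
          exact isSOSMatrix_zero _, by
        rw [Finset.sum_eq_single_of_mem j hj fun j' _ hne => by
          rw [Function.update_of_ne hne]; simp [matInner, integralY_zero],
          Function.update_self, zero_add]⟩
  rw [eval_integralY hmom] at this
  simpa only [heval] using this

end QuadModule

end SparsePMI

open SparsePMI in
theorem theorem3p10 {n m s t : ℕ} {q : Fin s → ℕ}
    (Y : Set (Fin m → ℝ)) (hY : IsCompact Y)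
    (ν : MeasureTheory.Measure (Fin m → ℝ)) (hsupp : ν.support = Y)
    (hmom : ∀ h : MvPolynomial (Fin m) ℝ,
      MeasureTheory.IntegrableOn (fun y => MvPolynomial.eval y h) Y ν)
    (f : MvPolynomial (Fin n) ℝ)
    (G : (j : Fin s) → Matrix (Fin (q j)) (Fin (q j)) (MvPolynomial (Fin n ⊕ Fin m) ℝ))
    (hG : ∀ j, (G j).IsSymm)
    (I : Fin t → Finset (Fin n)) (J : Fin t → Finset (Fin s))
    (hCS : SparsePMI.CorrelativeSparsity f G I J)
    (hArch : ∀ ℓ, SparsePMI.IsArchimedean (I ℓ) (SparsePMI.quadModule ν Y G (I ℓ) (J ℓ)))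
    (hpos : ∀ x ∈ SparsePMI.feasibleSet Y G, 0 < MvPolynomial.eval x f) :
    ∃ g : Fin t → MvPolynomial (Fin n) ℝ,
      (∀ ℓ, g ℓ ∈ SparsePMI.quadModule ν Y G (I ℓ) (J ℓ)) ∧ f = ∑ ℓ, g ℓ := by
  obtain ⟨F, hF, rfl⟩ := hCS.objective
  -- The positivity set of the `ℓ`-th quadratic module; it is compact by the Archimedean property.
  set K : Fin t → Set (Fin n → ℝ) := fun ℓ => {x | coordProj (I ℓ) x = x ∧
    ∀ a ∈ xRing (I ℓ), a ∈ quadModule ν Y G (I ℓ) (J ℓ) → 0 ≤ MvPolynomial.eval x a} with hK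
  have hball : ∀ ℓ (c : ℝ), MvPolynomial.C c - ∑ i ∈ I ℓ, MvPolynomial.X i ^ 2 ∈ xRing (I ℓ) :=
    fun ℓ c => sub_mem (Subalgebra.algebraMap_mem _ c)
      (sum_mem fun i hi => pow_mem (MvPolynomial.X_mem_supported.2 hi) 2)
  have hKc : ∀ ℓ, IsCompact (K ℓ) := by
    intro ℓ
    obtain ⟨c, hc, hcQ⟩ := hArch ℓ
    refine Metric.isCompact_of_isClosed_isBounded ?_ ?_
    · refine IsClosed.inter (isClosed_eq (continuous_coordProj _) continuous_id) ?_
      change IsClosed {x | ∀ a ∈ xRing (I ℓ), a ∈ quadModule ν Y G (I ℓ) (J ℓ) →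
        0 ≤ MvPolynomial.eval x a}
      rw [show {x | ∀ a ∈ xRing (I ℓ), a ∈ quadModule ν Y G (I ℓ) (J ℓ) →
        0 ≤ MvPolynomial.eval x a} = ⋂ a ∈ (xRing (I ℓ) : Set _) ∩ quadModule ν Y G (I ℓ) (J ℓ),
          {x | 0 ≤ MvPolynomial.eval x a} by ext; simp]
      exact isClosed_biInter fun a _ =>
        isClosed_le continuous_const (MvPolynomial.continuous_eval a)
    · refine isBounded_iff_forall_norm_le.2 ⟨√c, fun x hx => ?_⟩
      refine (pi_norm_le_iff_of_nonneg (Real.sqrt_nonneg _)).2 fun i => ?_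
      by_cases hi : i ∈ I ℓ
      · have h := hx.2 _ (hball ℓ c) hcQ
        simp only [map_sub, map_sum, map_pow, MvPolynomial.eval_C, MvPolynomial.eval_X] at h
        have h' := Finset.single_le_sum (f := fun i => x i ^ 2) (fun j _ => sq_nonneg (x j)) hi
        exact Real.abs_le_sqrt (by linarith)
      · rw [coordProj_eq_self.1 hx.1 i hi, norm_zero]
        exact Real.sqrt_nonneg _
  obtain ⟨g, hg, hsum, hgpos⟩ := exists_blockwise_pos I hCS.rip K hKc (fun ℓ x hx => hx.1) F hF
    fun x hx => hpos x fun j y hy => by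
      obtain ⟨ℓ, hℓ⟩ := hCS.cover j
      refine posSemidef_of_quadModule_nonneg hY hsupp hmom hG (hCS.constraints ℓ)
        (fun a ha haQ => ?_) hℓ hy
      rw [← mem_xRing_iff.1 ha]
      exact (hx ℓ).2 a ha haQ
  refine ⟨g, fun ℓ => ?_, hsum.symm⟩
  obtain ⟨c, hc, hcQ⟩ := hArch ℓ
  have hQ := isQuadraticModule_quadModule (G := G) hmom (I ℓ) (J ℓ)
  have hmem : (⟨g ℓ, hg ℓ⟩ : xRing (I ℓ)) ∈
      {a : xRing (I ℓ) | (a : MvPolynomial (Fin n) ℝ) ∈ quadModule ν Y G (I ℓ) (J ℓ)} :=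
    hQ.mem_of_forall_algHom_pos
      (exists_algebraMap_sub_mem hQ hc (b := ⟨_, hball ℓ c⟩) hcQ rfl) fun φ hφ => by
        obtain ⟨x, hx, hxe⟩ := exists_eval_of_algHom φ
        rw [hxe]
        exact hgpos ℓ x ⟨hx, fun a ha haQ => (hφ ⟨a, ha⟩ haQ).trans_eq (hxe ⟨a, ha⟩)⟩
  exact hmem
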